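/- Let $P(x)=x^4-x^3-x^2-x-1$, let $\beta_2$ be the real root of $P$ with $|\beta_2|<1$ and $\beta_3$ a non-real root of $P$, and for $i\in\mathbb Z$ put $\alpha^i=(\beta_2^i,\beta_3^i)\in\mathbb R\times\mathbb C$ (with componentwise operations; $\alpha^0=1$, $\alpha^1=\alpha$). Let $\mathcal D$ be the set of finite words $(\varepsilon_i)_{l\le i\le n}$, with $l,n\in\mathbb Z$, over $\{0,1\}$ that contain no block $1111$ of four consecutive digits, and let $\mathcal D^\infty$ be the set of sequences $(\varepsilon_i)_{i\ge l}$, $l\in\mathbb Z$, such that $(\varepsilon_i)_{l\le i\le n}\in\mathcal D$ for all $n\ge l$. For $\varepsilon=(\varepsilon_i)_{i\ge l}$ and $\varepsilon'=(\varepsilon'_i)_{i\ge l}$ in $\mathcal D^\infty$ (with the same $l$) put $$A_k(\varepsilon,\varepsilon')=\alpha^{-k+3}\sum_{i=l}^{k}(\varepsilon_i-\varepsilon'_i)\alpha^i\quad(k\ge l),\qquad S(\varepsilon,\varepsilon')=\{A_k(\varepsilon,\varepsilon') : k\ge l\}.$$ Let $$S=\Big\{\pm\sum_{i=0}^{3}c_i\alpha^i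 : (c_i)_{0\le i\le 3}\in\mathcal D\Big\}\cup\big\{\pm(\alpha^{-1}+1+\alpha^2),\ \pm(\alpha^{-2}+\alpha^{-1}+\alpha),\ \pm(\alpha^{-3}+\alpha^{-2}+1+\alpha^3)\big\},$$ a finite set. Then: 1. For every $(\varepsilon_i)_{i\ge l}\in\mathcal D^\infty$ the series $\sum_{i\ge l}\varepsilon_i\alpha^i$ converges (unconditionally) in $\mathbb R\times\mathbb C$. 2. For all $\varepsilon=(\varepsilon_i)_{i\ge l}$ and $\varepsilon'=(\varepsilon'_i)_{i\ge l}$ in $\mathcal D^\infty$, with $x=\sum_{i\ge l}\varepsilon_i\alpha^i$ and $y=\sum_{i\ge l}\varepsilon'_i\alpha^i$, one has $x=y$ if and only if $S(\varepsilon,\varepsilon')$ is finite; and if $x=y$, then $S(\varepsilon,\varepsilon')\subset S$. 3. $S=\bigcup_{(\varepsilon,\varepsilon')\in\Delta}S(\varepsilon,\varepsilon')$, where $\Delta$ is the set of pairs $\big((\varepsilon_i)_{i\ge l},(\varepsilon'_i)_{i\ge l}\big)\in\mathcal D^\infty\times\mathcal D^\infty$ (with a common $l\in\mathbb Z$, which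 may vary from pair to pair) such that $\sum_{i\ge l}\varepsilon_i\alpha^i=\sum_{i\ge l}\varepsilon'_i\alpha^i$. -/

import Mathlib

namespace Tetranacci

/-- The polynomial `P(x) = x⁴ - x³ - x² - x - 1`. -/
noncomputable def P : Polynomial ℤ :=
  Polynomial.X ^ 4 - Polynomial.X ^ 3 - Polynomial.X ^ 2 - Polynomial.X - 1

/-- The power `αⁱ = (β₂ⁱ, β₃ⁱ)` in `ℝ × ℂ`, for `i ∈ ℤ`; products in `ℝ × ℂ` are componentwise. -/
noncomputable def alphaPow (β₂ : ℝ) (β₃ : ℂ) (i : ℤ) : ℝ × ℂ := (β₂ ^ i, β₃ ^ i)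

/-- The word `(ε_i)_{l ≤ i ≤ n}` belongs to `𝒟`: its letters are `0` or `1` and it has no block
`1111`. Only the values `ε i` with `l ≤ i ≤ n` matter. -/
def IsWord (l n : ℤ) (ε : ℤ → ℤ) : Prop :=
  (∀ i, l ≤ i → i ≤ n → ε i = 0 ∨ ε i = 1) ∧
  ∀ i, l + 3 ≤ i → i ≤ n → ¬ (ε i = 1 ∧ ε (i - 1) = 1 ∧ ε (i - 2) = 1 ∧ ε (i - 3) = 1)

/-- The sequence `(ε_i)_{i ≥ l}` belongs to `𝒟^∞`. Only the values `ε i` with `l ≤ i` matter. -/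
def IsSeq (l : ℤ) (ε : ℤ → ℤ) : Prop := ∀ n, l ≤ n → IsWord l n ε

/-- The terms `ε_i αⁱ`, `i ≥ l`, of the series attached to `(ε_i)_{i ≥ l}`. -/
noncomputable def term (β₂ : ℝ) (β₃ : ℂ) (l : ℤ) (ε : ℤ → ℤ) (i : Set.Ici l) : ℝ × ℂ :=
  ε i • alphaPow β₂ β₃ i

/-- The value `∑_{i ≥ l} ε_i αⁱ`. -/
noncomputable def value (β₂ : ℝ) (β₃ : ℂ) (l : ℤ) (ε : ℤ → ℤ) : ℝ × ℂ :=
  ∑' i : Set.Ici l, term β₂ β₃ l ε i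

/-- The normalized partial difference `A_k(ε, ε') = α^{-k+3} ∑_{i=l}^{k} (ε_i - ε'_i) αⁱ`. -/
noncomputable def A (β₂ : ℝ) (β₃ : ℂ) (l : ℤ) (ε ε' : ℤ → ℤ) (k : ℤ) : ℝ × ℂ :=
  alphaPow β₂ β₃ (-k + 3) * ∑ i ∈ Finset.Icc l k, (ε i - ε' i) • alphaPow β₂ β₃ i

/-- The set `S(ε, ε') = {A_k(ε, ε') : k ≥ l}`. -/
def diffSet (β₂ : ℝ) (β₃ : ℂ) (l : ℤ) (ε ε' : ℤ → ℤ) : Set (ℝ × ℂ) :=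
  {z | ∃ k, l ≤ k ∧ z = A β₂ β₃ l ε ε' k}

/-- The elements of the explicit set `S`, up to sign. -/
def basicStates (β₂ : ℝ) (β₃ : ℂ) : Set (ℝ × ℂ) :=
  {z | ∃ c : ℤ → ℤ, IsWord 0 3 c ∧ z = ∑ i ∈ Finset.Icc (0 : ℤ) 3, c i • alphaPow β₂ β₃ i} ∪
  {alphaPow β₂ β₃ (-1) + alphaPow β₂ β₃ 0 + alphaPow β₂ β₃ 2,
   alphaPow β₂ β₃ (-2) + alphaPow β₂ β₃ (-1) + alphaPow β₂ β₃ 1,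
   alphaPow β₂ β₃ (-3) + alphaPow β₂ β₃ (-2) + alphaPow β₂ β₃ 0 + alphaPow β₂ β₃ 3}

/-- The explicit set `S`. -/
def states (β₂ : ℝ) (β₃ : ℂ) : Set (ℝ × ℂ) :=
  {z | z ∈ basicStates β₂ β₃ ∨ -z ∈ basicStates β₂ β₃}

/-- The set `Δ` of pairs of sequences in `𝒟^∞`, starting at the same index `l`, with equal
values; an element is recorded as `(l, ε, ε')`. -/
def Delta (β₂ : ℝ) (β₃ : ℂ) : Set (ℤ × (ℤ → ℤ) × (ℤ → ℤ)) :=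
  {p | IsSeq p.1 p.2.1 ∧ IsSeq p.1 p.2.2 ∧ value β₂ β₃ p.1 p.2.1 = value β₂ β₃ p.1 p.2.2}

end Tetranacci

open Filter Topology

namespace Tetranacci

/-! Each `A_k` lies in `ℤ[α]`, and `α A_{k+1} = A_k + (ε_{k+1} - ε'_{k+1}) α⁴`. In the basis `1, α,
α², α³` this is an integer recursion; together with the two current runs of digits `1` it makes
pairs of sequences the same thing as infinite paths of an automaton (`isPath_trace_iff`).

Write `u_n` for the value at a root `β` of the state after `n` digits. The values of two sequences
agree exactly when `βⁿ u_n → 0` for both roots (`value_eq_value_iff`). This holds if the `u_n` are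
bounded, in particular if they take finitely many values. Conversely it forces `‖u_n‖ ≤ ‖β‖⁴ / (1 -
‖β‖)` (`norm_eval_trace_le`), so the path never leaves an explicit region. A finite search with
integer arithmetic shows that such a path stays in `liveStates`, whose vectors are exactly those of
`S`.

For the last claim, each live state is reachable from the start and has a live successor. A path
through it can therefore be kept live ever after; it meets finitely many states, so its two
sequences have equal values. -/

/-! ### The automaton of normalized differences -/

/-- The element `a + bα + cα² + dα³` of `ℤ[α]`, together with the numbers of consecutive digits
`1` with which two words end. -/
@[ext] structure State where
  a : ℤ
  b : ℤ
  c : ℤ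
  d : ℤ
  h : ℕ
  g : ℕ

/-- The state of a pair of empty words. -/
def State.start : State := ⟨0, 0, 0, 0, 0, 0⟩

/-- The state reached when a pair of digits is appended to a pair of words. -/
def State.step (s : State) (p : ℤ × ℤ) : State :=
  ⟨s.b - s.a, s.c - s.a, s.d - s.a, s.a + (p.1 - p.2),
    if p.1 = 1 then s.h + 1 else 0, if p.2 = 1 then s.g + 1 else 0⟩

/-- The pairs of digits that create no block `1111`. -/
def State.moves (s : State) : List (ℤ × ℤ) :=
  [(0, 0), (0, 1), (1, 0), (1, 1)].filter
    fun p => (p.1 == 0 || decide (s.h < 3)) && (p.2 == 0 || decide (s.g < 3))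

/-- The test by which a state is too far from the origin in `ℝ` or in `ℂ`. -/
def State.outside (s : State) : Bool :=
  decide (16010 + (s.b.natAbs + s.c.natAbs + s.d.natAbs) <
    (10000 * s.a - 7748 * s.b + 6003 * s.c - 4651 * s.d).natAbs) ||
  decide (60920 + ((s.a.natAbs + s.b.natAbs + s.c.natAbs + s.d.natAbs) ^ 2 : ℕ) <
    s.a * (10000 * s.a - 1528 * s.b - 13158 * s.c + 3033 * s.d) +
      s.b * (6696 * s.b - 1023 * s.c - 8810 * s.d) + s.c * (4483 * s.c - 685 * s.d) +
      3002 * (s.d * s.d))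

/-- Application of a function to a natural number that is evaluated first. -/
def forceNat {X : Sort*} (x : ℕ) (f : ℕ → X) : X :=
  match x with
  | 0 => f 0
  | n + 1 => f (n + 1)

theorem forceNat_eq {X : Sort*} (x : ℕ) (f : ℕ → X) : forceNat x f = f x := by
  cases x <;> rfl

/-- Application of a function to an integer that is evaluated first. -/
def forceInt {X : Sort*} (x : ℤ) (f : ℤ → X) : X :=
  match x with
  | .ofNat n => forceNat n fun n => f (.ofNat n)
  | .negSucc n => forceNat n fun n => f (.negSucc n)

theorem forceInt_eq {X : Sort*} (x : ℤ) (f : ℤ → X) : forceInt x f = f x := by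
  cases x <;> simp only [forceInt, forceNat_eq]

/-- Application of a function to a state that is evaluated first, so that the kernel can reuse the
result for an equal state. -/
def State.force {X : Sort*} (s : State) (f : State → X) : X :=
  forceInt s.a fun a => forceInt s.b fun b => forceInt s.c fun c => forceInt s.d fun d =>
    forceNat s.h fun h => forceNat s.g fun g => f ⟨a, b, c, d, h, g⟩

theorem State.force_eq {X : Sort*} (s : State) (f : State → X) : s.force f = f s := by
  simp only [State.force, forceInt_eq, forceNat_eq]

/-- Every path of length `n` from the state passes the test `State.outside`. -/
def State.dead : ℕ → State → Bool
  | 0, s => s.force State.outside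
  | n + 1, s => s.force fun s => s.outside || s.moves.all fun p => (s.step p).dead n

/-- The states that occur for pairs of sequences with equal values, in the order of a breadth-first
search from `State.start`. -/
def liveStates : List State := [
  ⟨0, 0, 0, 0, 0, 0⟩, ⟨0, 0, 0, -1, 0, 1⟩, ⟨0, 0, 0, 1, 1, 0⟩, ⟨0, 0, 0, 0, 1, 1⟩,
  ⟨0, 0, -1, 0, 0, 0⟩, ⟨0, 0, -1, -1, 0, 2⟩, ⟨0, 0, -1, 0, 1, 2⟩, ⟨0, 0, 1, 0, 0, 0⟩,
  ⟨0, 0, 1, 1, 2, 0⟩, ⟨0, 0, 1, 0, 2, 1⟩, ⟨0, 0, 0, -1, 0, 2⟩, ⟨0, 0, 0, 1, 2, 0⟩,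
  ⟨0, 0, 0, 0, 2, 2⟩, ⟨0, -1, 0, 0, 0, 0⟩, ⟨0, -1, 0, -1, 0, 1⟩, ⟨0, -1, 0, 1, 1, 0⟩,
  ⟨0, -1, 0, 0, 1, 1⟩, ⟨0, -1, -1, 0, 0, 0⟩, ⟨0, -1, -1, -1, 0, 3⟩, ⟨0, -1, -1, 0, 1, 3⟩,
  ⟨0, -1, 0, -1, 0, 3⟩, ⟨0, -1, 0, 1, 2, 0⟩, ⟨0, -1, 0, 0, 2, 3⟩, ⟨0, 1, 0, 0, 0, 0⟩,
  ⟨0, 1, 0, -1, 0, 1⟩, ⟨0, 1, 0, 1, 1, 0⟩, ⟨0, 1, 0, 0, 1, 1⟩, ⟨0, 1, 1, 0, 0, 0⟩,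
  ⟨0, 1, 1, 1, 3, 0⟩, ⟨0, 1, 1, 0, 3, 1⟩, ⟨0, 1, 0, -1, 0, 2⟩, ⟨0, 1, 0, 1, 3, 0⟩,
  ⟨0, 1, 0, 0, 3, 2⟩, ⟨0, 0, -1, -1, 0, 3⟩, ⟨0, 0, -1, 0, 1, 3⟩, ⟨0, 0, 1, 1, 3, 0⟩,
  ⟨0, 0, 1, 0, 3, 1⟩, ⟨0, 0, 0, -1, 0, 3⟩, ⟨0, 0, 0, 1, 3, 0⟩, ⟨0, 0, 0, 0, 3, 3⟩,
  ⟨-1, 0, 0, 0, 0, 0⟩, ⟨-1, 0, 0, -1, 0, 1⟩, ⟨-1, 0, 0, 0, 1, 1⟩, ⟨-1, 0, -1, 0, 0, 0⟩,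
  ⟨-1, 0, -1, -1, 0, 2⟩, ⟨-1, 0, -1, 0, 1, 2⟩, ⟨-1, 0, 1, 0, 0, 0⟩, ⟨-1, 0, 1, 0, 2, 1⟩,
  ⟨-1, 0, 0, -1, 0, 2⟩, ⟨-1, 0, 0, 0, 2, 2⟩, ⟨-1, -1, 0, 0, 0, 0⟩, ⟨-1, -1, 0, -1, 0, 1⟩,
  ⟨-1, -1, 0, 0, 1, 1⟩, ⟨-1, -1, -1, 0, 0, 0⟩, ⟨1, 0, 0, 0, 0, 0⟩, ⟨1, 0, 0, 1, 1, 0⟩,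
  ⟨1, 0, 0, 0, 1, 1⟩, ⟨1, 0, -1, 0, 0, 0⟩, ⟨1, 0, -1, 0, 1, 2⟩, ⟨1, 0, 1, 0, 0, 0⟩,
  ⟨1, 0, 1, 1, 2, 0⟩, ⟨1, 0, 1, 0, 2, 1⟩, ⟨1, 0, 0, 1, 2, 0⟩, ⟨1, 0, 0, 0, 2, 2⟩,
  ⟨1, 1, 0, 0, 0, 0⟩, ⟨1, 1, 0, 1, 1, 0⟩, ⟨1, 1, 0, 0, 1, 1⟩, ⟨1, 1, 1, 0, 0, 0⟩,
  ⟨1, 1, 1, 0, 1, 0⟩, ⟨1, 1, 0, 0, 1, 0⟩, ⟨1, 1, 1, 0, 2, 0⟩, ⟨1, 0, 1, 0, 1, 0⟩,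
  ⟨1, 0, 0, 0, 1, 0⟩, ⟨1, 0, 1, 0, 2, 0⟩, ⟨1, 2, 1, 0, 1, 0⟩, ⟨1, 2, 1, 0, 3, 0⟩,
  ⟨1, 1, 1, 0, 3, 0⟩, ⟨0, 1, 1, 0, 1, 0⟩, ⟨0, 1, 0, -1, 0, 0⟩, ⟨0, 1, 0, 0, 1, 0⟩,
  ⟨0, 1, 0, -1, 1, 2⟩, ⟨0, 1, 1, 0, 2, 0⟩, ⟨0, 0, 1, 0, 1, 0⟩, ⟨-1, -1, -1, 0, 0, 1⟩,
  ⟨-1, -1, 0, 0, 0, 1⟩, ⟨-1, -1, -1, 0, 0, 2⟩, ⟨-1, -2, -1, 0, 0, 1⟩, ⟨-1, -2, -1, 0, 0, 3⟩,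
  ⟨-1, 0, -1, 0, 0, 1⟩, ⟨-1, 0, 0, 0, 0, 1⟩, ⟨-1, 0, -1, 0, 0, 2⟩, ⟨-1, -1, -1, 0, 0, 3⟩,
  ⟨0, -1, -1, 0, 0, 1⟩, ⟨0, -1, 0, 1, 0, 0⟩, ⟨0, -1, 0, 0, 0, 1⟩, ⟨0, -1, 0, 1, 2, 1⟩,
  ⟨0, -1, -1, 0, 0, 2⟩, ⟨0, 0, -1, 0, 0, 1⟩, ⟨1, 0, -1, 0, 0, 1⟩, ⟨1, 1, 0, 1, 2, 0⟩,
  ⟨1, 1, 0, 0, 2, 1⟩, ⟨1, 0, -1, 0, 1, 1⟩, ⟨1, 0, 0, 0, 2, 1⟩, ⟨1, 1, 0, 1, 3, 0⟩,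
  ⟨1, 1, 0, 0, 3, 1⟩, ⟨0, 1, 0, 1, 2, 0⟩, ⟨0, 1, 0, 0, 2, 1⟩, ⟨-1, 0, 1, 0, 1, 0⟩,
  ⟨-1, -1, 0, -1, 0, 2⟩, ⟨-1, -1, 0, 0, 1, 2⟩, ⟨-1, 0, 1, 0, 1, 1⟩, ⟨-1, 0, 0, 0, 1, 2⟩,
  ⟨-1, -1, 0, -1, 0, 3⟩, ⟨-1, -1, 0, 0, 1, 3⟩, ⟨0, -1, 0, -1, 0, 2⟩, ⟨0, -1, 0, 0, 1, 2⟩,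
  ⟨-1, -2, -1, 0, 0, 2⟩, ⟨0, -1, 0, 1, 3, 1⟩, ⟨1, 0, 1, 1, 3, 0⟩, ⟨1, 0, 1, 0, 3, 1⟩,
  ⟨1, 0, 0, 1, 3, 0⟩, ⟨1, 0, 0, 0, 3, 2⟩, ⟨1, 2, 1, 0, 2, 0⟩, ⟨0, 1, 0, -1, 1, 3⟩,
  ⟨-1, 0, -1, -1, 0, 3⟩, ⟨-1, 0, -1, 0, 1, 3⟩, ⟨-1, 0, 0, -1, 0, 3⟩, ⟨-1, 0, 0, 0, 2, 3⟩]

/-- Equality of states, as a Boolean test. -/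
def State.same (s t : State) : Bool :=
  s.h.beq t.h && (s.g.beq t.g && (decide (s.a = t.a) && (decide (s.b = t.b) &&
    (decide (s.c = t.c) && decide (s.d = t.d)))))

/-- Membership in a list of states, as a Boolean test. -/
def State.isIn (s : State) (L : List State) : Bool := L.any s.same

theorem State.same_iff {s t : State} : s.same t = true ↔ s = t := by
  rcases s with ⟨a, b, c, d, h, g⟩
  rcases t with ⟨a', b', c', d', h', g'⟩
  simp only [State.same, Bool.and_eq_true, Nat.beq_eq, decide_eq_true_eq, State.mk.injEq]
  tauto

theorem State.isIn_iff {s : State} {L : List State} : s.isIn L = true ↔ s ∈ L := by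
  simp [State.isIn, State.same_iff]

/-! ### Finite computations on the live states -/

theorem start_mem_liveStates : State.start ∈ liveStates :=
  State.isIn_iff.1 (by decide +kernel)

/-- The lookahead disposes of the exits from the list: every continuation of such an exit meets the
size test within 8 steps. -/
theorem liveStates_all_isIn_or_dead :
    (liveStates.all fun s => s.moves.all fun p =>
      (s.step p).isIn liveStates || (s.step p).dead 8) = true := by decide +kernel

theorem liveStates_all_any_isIn :
    (liveStates.all fun s => s.moves.any fun p => (s.step p).isIn liveStates) = true := by
  decide +kernel

theorem step_mem_liveStates {s : State} (hs : s ∈ liveStates) {p : ℤ × ℤ} (hp : p ∈ s.moves)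
    (h : (s.step p).dead 8 = false) : s.step p ∈ liveStates := by
  have := List.all_eq_true.1 (List.all_eq_true.1 liveStates_all_isIn_or_dead s hs) p hp
  rw [h, Bool.or_false] at this
  exact State.isIn_iff.1 this

theorem exists_step_mem_liveStates {s : State} (hs : s ∈ liveStates) :
    ∃ p ∈ s.moves, s.step p ∈ liveStates := by
  obtain ⟨p, hp, h⟩ := List.any_eq_true.1 (List.all_eq_true.1 liveStates_all_any_isIn s hs)
  exact ⟨p, hp, State.isIn_iff.1 h⟩

/-- Every state of the second list is in the first one or is reached in one step from a state of the
first list or from an earlier state of the second one. -/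
def grownFrom : List State → List State → Bool
  | _, [] => true
  | seen, s :: rest =>
    (s.isIn seen || seen.any fun r => r.moves.any fun p => (r.step p).same s) &&
      grownFrom (s :: seen) rest

/-- The breadth-first order of the list puts a predecessor before each state, so one pass suffices.
-/
theorem grownFrom_liveStates : grownFrom [State.start] liveStates = true := by decide +kernel

/-- The states of pairs of words. -/
inductive Reachable : State → Prop
  | start : Reachable State.start
  | step {s : State} {p : ℤ × ℤ} : Reachable s → p ∈ s.moves → Reachable (s.step p)

theorem reachable_of_grownFrom (L : List State) : ∀ seen : List State, grownFrom seen L = true →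
    (∀ s ∈ seen, Reachable s) → ∀ s ∈ L, Reachable s := by
  induction L with
  | nil => simp
  | cons t L ih =>
    intro seen hL hseen
    rw [grownFrom, Bool.and_eq_true, Bool.or_eq_true] at hL
    have ht : Reachable t := by
      rcases hL.1 with h | h
      · exact hseen t (State.isIn_iff.1 h)
      · obtain ⟨r, hr, h⟩ := List.any_eq_true.1 h
        obtain ⟨p, hp, h⟩ := List.any_eq_true.1 h
        exact State.same_iff.1 h ▸ (hseen r hr).step hp
    intro s hs
    rcases List.mem_cons.1 hs with rfl | hs
    · exact ht
    · refine ih _ hL.2 (fun r hr => ?_) s hs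
      rcases List.mem_cons.1 hr with rfl | hr
      · exact ht
      · exact hseen r hr

theorem reachable_of_mem_liveStates {s : State} (hs : s ∈ liveStates) : Reachable s :=
  reachable_of_grownFrom liveStates _ grownFrom_liveStates
    (fun _ ht => List.mem_singleton.1 ht ▸ Reachable.start) s hs

/-! ### Infinite paths -/

/-- An infinite path of states, with the digits appended on the way. -/
structure IsPath (s : ℕ → State) (p : ℕ → ℤ × ℤ) : Prop where
  moves : ∀ n, p n ∈ (s n).moves
  step : ∀ n, s (n + 1) = (s n).step (p n)

theorem IsPath.dead_eq_false {s : ℕ → State} {p : ℕ → ℤ × ℤ} (h : IsPath s p)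
    (hs : ∀ n, (s n).outside = false) (k n : ℕ) : (s n).dead k = false := by
  induction k generalizing n with
  | zero => rw [State.dead, State.force_eq, hs n]
  | succ k ih =>
    rw [State.dead, State.force_eq, hs n, Bool.false_or, List.all_eq_false]
    exact ⟨p n, h.moves n, by rw [← h.step n, ih]; simp⟩

theorem IsPath.mem_liveStates {s : ℕ → State} {p : ℕ → ℤ × ℤ} (h : IsPath s p)
    (h0 : s 0 = State.start) (hs : ∀ n, (s n).outside = false) (n : ℕ) : s n ∈ liveStates := by
  induction n with
  | zero => exact h0 ▸ start_mem_liveStates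
  | succ n ih =>
    rw [h.step n]
    exact step_mem_liveStates ih (h.moves n) (h.step n ▸ h.dead_eq_false hs 8 (n + 1))

theorem exists_isPath_liveStates {s : State} (hs : s ∈ liveStates) :
    ∃ t p, IsPath t p ∧ t 0 = s ∧ ∀ n, t n ∈ liveStates := by
  choose! f hf hf' using fun (s : State) (hs : s ∈ liveStates) => exists_step_mem_liveStates hs
  let t : ℕ → State := fun n => Nat.rec s (fun _ r => r.step (f r)) n
  have ht : ∀ n, t n ∈ liveStates := by
    intro n
    induction n with
    | zero => exact hs
    | succ n ih => exact hf' _ ih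
  exact ⟨t, fun n => f (t n), ⟨fun n => hf _ (ht n), fun n => rfl⟩, rfl, ht⟩

theorem IsPath.cons {t : ℕ → State} {p : ℕ → ℤ × ℤ} (h : IsPath t p) {s : State} {q : ℤ × ℤ}
    (hq : q ∈ s.moves) (ht : t 0 = s.step q) :
    IsPath (fun n => Nat.casesOn n s t) fun n => Nat.casesOn n q p := by
  refine ⟨fun n => ?_, fun n => ?_⟩
  · cases n with
    | zero => exact hq
    | succ n => exact h.moves n
  · cases n with
    | zero => exact ht
    | succ n => exact h.step n

/-- Induction on reachability, prepending one step at a time to the given path. -/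
theorem Reachable.exists_isPath {s : State} (hs : Reachable s) {t : ℕ → State} {p : ℕ → ℤ × ℤ}
    (h : IsPath t p) (h0 : t 0 = s) :
    ∃ t' p' m, IsPath t' p' ∧ t' 0 = State.start ∧ ∀ n, t' (n + (m + 1)) = t n := by
  induction hs generalizing t p with
  | start =>
    -- The digits `(0, 0)` loop at the start. The extra step makes the shift positive, as needed
    -- because `A_k` never uses the state of the empty words.
    exact ⟨_, _, 0, h.cons (s := State.start) (q := (0, 0)) (by decide) (h0.trans rfl), rfl,
      fun n => rfl⟩
  | step hr hp ih =>
    obtain ⟨t', p', m, h1, h2, h3⟩ := ih (h.cons hp h0) rfl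
    refine ⟨t', p', m + 1, h1, h2, fun n => ?_⟩
    rw [show n + (m + 1 + 1) = (n + 1) + (m + 1) by omega, h3]

/-! ### Pairs of sequences as paths -/

/-- The states of the pairs of words that start at the index `l`. -/
def trace (l : ℤ) (ε ε' : ℤ → ℤ) : ℕ → State
  | 0 => State.start
  | n + 1 => (trace l ε ε' n).step (ε (l + n), ε' (l + n))

theorem isSeq_iff {l : ℤ} {ε : ℤ → ℤ} : IsSeq l ε ↔ (∀ n : ℕ, ε (l + n) = 0 ∨ ε (l + n) = 1) ∧
    ∀ n : ℕ, ¬ (ε (l + n) = 1 ∧ ε (l + (n + 1 : ℕ)) = 1 ∧ ε (l + (n + 2 : ℕ)) = 1 ∧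
      ε (l + (n + 3 : ℕ)) = 1) := by
  constructor
  · intro h
    refine ⟨fun n => (h (l + n) (by omega)).1 _ (by omega) le_rfl, fun n hn => ?_⟩
    exact (h (l + (n + 3 : ℕ)) (by omega)).2 _ (by omega) le_rfl ⟨hn.2.2.2,
      (congrArg ε (by push_cast; ring)).trans hn.2.2.1,
      (congrArg ε (by push_cast; ring)).trans hn.2.1, (congrArg ε (by push_cast; ring)).trans hn.1⟩
  · rintro ⟨h1, h2⟩ n -
    refine ⟨fun i hi _ => ?_, fun i hi _ h => ?_⟩
    · obtain ⟨k, rfl⟩ := Int.le.dest hi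
      exact h1 k
    · obtain ⟨k, rfl⟩ := Int.le.dest hi
      exact h2 k ⟨(congrArg ε (by ring)).trans h.2.2.2,
        (congrArg ε (by push_cast; ring)).trans h.2.2.1,
        (congrArg ε (by push_cast; ring)).trans h.2.1, (congrArg ε (by push_cast; ring)).trans h.1⟩

/-- The number of consecutive letters `1` with which the word of the first `n` letters ends. -/
def runLength (δ : ℕ → ℤ) : ℕ → ℕ
  | 0 => 0
  | n + 1 => if δ n = 1 then runLength δ n + 1 else 0

theorem eq_one_of_le_runLength {δ : ℕ → ℤ} (n j : ℕ) (h : j ≤ runLength δ n) :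
    j ≤ n ∧ ∀ i < j, δ (n - 1 - i) = 1 := by
  induction n generalizing j with
  | zero => simp_all [runLength]
  | succ n ih =>
    rw [runLength] at h
    split_ifs at h with h1
    · cases j with
      | zero => simp
      | succ j =>
        obtain ⟨h2, h3⟩ := ih j (by omega)
        refine ⟨by omega, fun i hi => ?_⟩
        cases i with
        | zero => simpa using h1
        | succ i =>
          rw [← h3 i (by omega)]
          congr 1
          omega
    · obtain rfl : j = 0 := by omega
      simp

theorem runLength_lt_three_iff (δ : ℕ → ℤ) :
    (∀ n, δ n = 1 → runLength δ n < 3) ↔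
      ∀ n, ¬ (δ n = 1 ∧ δ (n + 1) = 1 ∧ δ (n + 2) = 1 ∧ δ (n + 3) = 1) := by
  constructor
  · rintro h n ⟨h0, h1, h2, h3⟩
    have := h (n + 3) h3
    simp only [runLength, h0, h1, h2, if_true] at this
    omega
  · intro h n hn
    by_contra! h3
    obtain ⟨h4, h5⟩ := eq_one_of_le_runLength n 3 h3
    obtain ⟨m, rfl⟩ := Nat.exists_eq_add_of_le' h4
    exact h m ⟨by simpa using h5 2 (by omega), by simpa using h5 1 (by omega),
      by simpa using h5 0 (by omega), hn⟩

theorem trace_h (l : ℤ) (ε ε' : ℤ → ℤ) (n : ℕ) :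
    (trace l ε ε' n).h = runLength (fun k => ε (l + k)) n := by
  induction n with
  | zero => rfl
  | succ n ih => simp only [trace, State.step, runLength, ih]

theorem trace_g (l : ℤ) (ε ε' : ℤ → ℤ) (n : ℕ) :
    (trace l ε ε' n).g = runLength (fun k => ε' (l + k)) n := by
  induction n with
  | zero => rfl
  | succ n ih => simp only [trace, State.step, runLength, ih]

theorem State.mem_moves {s : State} {p : ℤ × ℤ} : p ∈ s.moves ↔
    ((p.1 = 0 ∨ p.1 = 1) ∧ (p.1 = 1 → s.h < 3)) ∧ ((p.2 = 0 ∨ p.2 = 1) ∧ (p.2 = 1 → s.g < 3)) := by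
  obtain ⟨e, f⟩ := p
  simp only [State.moves, List.mem_filter, List.mem_cons, Prod.mk.injEq, List.not_mem_nil, or_false,
    Bool.and_eq_true, Bool.or_eq_true, beq_iff_eq, decide_eq_true_eq]
  constructor
  · rintro ⟨⟨rfl, rfl⟩ | ⟨rfl, rfl⟩ | ⟨rfl, rfl⟩ | ⟨rfl, rfl⟩, h⟩ <;> simp_all
  · rintro ⟨⟨rfl | rfl, h⟩, rfl | rfl, h'⟩ <;> simp_all

theorem isPath_trace_iff {l : ℤ} {ε ε' : ℤ → ℤ} :
    (IsPath (trace l ε ε') fun n => (ε (l + n), ε' (l + n))) ↔ IsSeq l ε ∧ IsSeq l ε' := by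
  rw [isSeq_iff, isSeq_iff, ← runLength_lt_three_iff fun k : ℕ => ε (l + k),
    ← runLength_lt_three_iff fun k : ℕ => ε' (l + k)]
  constructor
  · intro h
    have := fun n => State.mem_moves.1 (h.moves n)
    simp only [trace_h, trace_g] at this
    exact ⟨⟨fun n => (this n).1.1, fun n => (this n).1.2⟩, fun n => (this n).2.1,
      fun n => (this n).2.2⟩
  · rintro ⟨⟨h1, h2⟩, h3, h4⟩
    refine ⟨fun n => State.mem_moves.2 ?_, fun n => rfl⟩
    rw [trace_h, trace_g]
    exact ⟨⟨h1 n, h2 n⟩, h3 n, h4 n⟩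

theorem IsPath.exists_trace {t : ℕ → State} {p : ℕ → ℤ × ℤ} (h : IsPath t p)
    (h0 : t 0 = State.start) : ∃ ε ε', IsSeq 0 ε ∧ IsSeq 0 ε' ∧ trace 0 ε ε' = t := by
  have ht : trace 0 (fun i => (p i.toNat).1) (fun i => (p i.toNat).2) = t := by
    funext n
    induction n with
    | zero => exact h0.symm
    | succ n ih => rw [trace, ih, h.step n]; simp
  refine ⟨fun i => (p i.toNat).1, fun i => (p i.toNat).2, ?_⟩
  rw [← and_assoc, ← isPath_trace_iff]
  refine ⟨?_, ht⟩
  rw [ht]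
  simpa using h

/-! ### Evaluation at a root of `P` -/

/-- The value at `β` of the element of `ℤ[α]` that belongs to a state. -/
def State.eval {K : Type*} [Field K] (β : K) (s : State) : K :=
  s.a + s.b * β + s.c * β ^ 2 + s.d * β ^ 3

section Field

variable {K : Type*} [Field K] {β : K}

theorem aeval_P {K : Type*} [Field K] (β : K) :
    Polynomial.aeval β P = β ^ 4 - β ^ 3 - β ^ 2 - β - 1 := by
  simp [P]

/-- The coordinates in `State.step` come from `β⁻¹ = β³ - β² - β - 1`. -/
theorem State.mul_eval_step (hβ : β ^ 4 - β ^ 3 - β ^ 2 - β - 1 = 0) (s : State) (p : ℤ × ℤ) :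
    β * (s.step p).eval β = s.eval β + ((p.1 - p.2 : ℤ) : K) * β ^ 4 := by
  simp only [State.eval, State.step]
  push_cast
  linear_combination (s.a : K) * hβ

theorem pow_mul_eval_trace (hβ : β ^ 4 - β ^ 3 - β ^ 2 - β - 1 = 0) (l : ℤ) (ε ε' : ℤ → ℤ) (n : ℕ) :
    β ^ n * (trace l ε ε' n).eval β =
      β ^ 4 * ∑ j ∈ Finset.range n, ((ε (l + j) - ε' (l + j) : ℤ) : K) * β ^ j := by
  induction n with
  | zero => simp [trace, State.eval, State.start]
  | succ n ih =>
    rw [Finset.sum_range_succ, mul_add, ← ih, trace, pow_succ, mul_assoc,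
      State.mul_eval_step hβ]
    ring

theorem sum_Icc_add_eq_sum_range {M : Type*} [AddCommMonoid M] (f : ℤ → M) (l : ℤ) (n : ℕ) :
    ∑ i ∈ Finset.Icc l (l + n), f i = ∑ j ∈ Finset.range (n + 1), f (l + j) := by
  symm
  refine Finset.sum_bij (fun j _ => l + (j : ℤ)) (fun j hj => ?_) (fun i _ j _ h => ?_)
    (fun i hi => ?_) fun _ _ => rfl
  · have := Finset.mem_range.1 hj
    exact Finset.mem_Icc.2 (by omega)
  · simpa using h
  · have := Finset.mem_Icc.1 hi
    exact ⟨(i - l).toNat, Finset.mem_range.2 (by omega), by omega⟩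

theorem zpow_mul_sum_Icc (hβ0 : β ≠ 0) (hβ : β ^ 4 - β ^ 3 - β ^ 2 - β - 1 = 0) (l : ℤ)
    (ε ε' : ℤ → ℤ) (n : ℕ) :
    β ^ (-(l + n) + 3) * ∑ i ∈ Finset.Icc l (l + n), (ε i - ε' i) • β ^ i =
      (trace l ε ε' (n + 1)).eval β := by
  have h := pow_mul_eval_trace hβ l ε ε' (n + 1)
  rw [sum_Icc_add_eq_sum_range]
  simp only [zsmul_eq_mul, zpow_add₀ hβ0 l, zpow_natCast]
  apply mul_left_cancel₀ (pow_ne_zero (n + 1) hβ0)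
  rw [h, Finset.mul_sum, Finset.mul_sum, Finset.mul_sum]
  refine Finset.sum_congr rfl fun j _ => ?_
  rw [zpow_add₀ hβ0, neg_add, zpow_add₀ hβ0, zpow_neg, zpow_neg, zpow_natCast]
  have h1 := zpow_ne_zero l hβ0
  have h3 : β ^ (3 : ℤ) = β ^ 3 := by norm_cast
  rw [h3]
  field_simp
  ring

end Field

/-! ### Convergence and bounds at a root inside the unit disc -/

section Normed

variable {K : Type*} [NormedField K] {β : K}

/-- The bound `B` is the fixed point of `x ↦ ‖β‖ x + ‖β‖⁴`, so `‖β‖ⁿ (‖u n‖ - B)` is nondecreasing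
in `n`. Once positive it could not be dominated by a sequence tending to `0`. -/
theorem norm_le_of_tendsto_pow_mul {u : ℕ → K} (h0 : 0 < ‖β‖) (h1 : ‖β‖ < 1)
    (hu : ∀ n, ‖β * u (n + 1) - u n‖ ≤ ‖β‖ ^ 4) (hlim : Tendsto (fun n => β ^ n * u n) atTop (𝓝 0))
    (n : ℕ) : ‖u n‖ ≤ ‖β‖ ^ 4 / (1 - ‖β‖) := by
  by_contra! h
  set B := ‖β‖ ^ 4 / (1 - ‖β‖) with hB
  have hBB : B * (1 - ‖β‖) = ‖β‖ ^ 4 := div_mul_cancel₀ _ (by linarith)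
  have hB0 : 0 ≤ B := by have := pow_pos h0 4; rw [hB]; exact div_nonneg this.le (by linarith)
  have key : ∀ k, ‖β‖ ^ n * (‖u n‖ - B) ≤ ‖β‖ ^ (n + k) * (‖u (n + k)‖ - B) := by
    intro k
    induction k with
    | zero => simp
    | succ k ih =>
      refine ih.trans ?_
      have h2 : ‖u (n + k)‖ ≤ ‖β‖ * ‖u (n + k + 1)‖ + ‖β‖ ^ 4 := by
        have := norm_sub_norm_le (u (n + k)) (β * u (n + k + 1))
        rw [norm_sub_rev, norm_mul] at this
        linarith [hu (n + k)]
      rw [← add_assoc, pow_succ ‖β‖ (n + k), mul_assoc]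
      refine mul_le_mul_of_nonneg_left ?_ (by positivity)
      linarith
  have hl : Tendsto (fun k => ‖β ^ (n + k) * u (n + k)‖) atTop (𝓝 0) := by
    have := hlim.norm
    rw [norm_zero] at this
    exact this.comp (tendsto_add_atTop_nat n |>.congr fun k => add_comm k n)
  have : ‖β‖ ^ n * (‖u n‖ - B) ≤ 0 := by
    refine ge_of_tendsto' hl fun k => (key k).trans ?_
    rw [norm_mul, norm_pow]
    exact mul_le_mul_of_nonneg_left (by linarith) (by positivity)
  have : 0 < ‖β‖ ^ n * (‖u n‖ - B) := mul_pos (by positivity) (by linarith)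
  linarith

theorem tendsto_pow_mul_of_norm_le {u : ℕ → K} (h1 : ‖β‖ < 1) {C : ℝ} (hC : ∀ n, ‖u n‖ ≤ C) :
    Tendsto (fun n => β ^ n * u n) atTop (𝓝 0) := by
  refine squeeze_zero_norm (a := fun n => ‖β‖ ^ n * C) (fun n => ?_) ?_
  · rw [norm_mul, norm_pow]
    exact mul_le_mul_of_nonneg_left (hC n) (by positivity)
  · simpa using (tendsto_pow_atTop_nhds_zero_of_lt_one (norm_nonneg β) h1).mul_const C

theorem summable_digits_mul_zpow [CompleteSpace K] (h0 : β ≠ 0) (h1 : ‖β‖ < 1) {l : ℤ} {ε : ℤ → ℤ}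
    (hε : IsSeq l ε) : Summable fun n : ℕ => (ε (l + n) : K) * β ^ (l + n) := by
  refine Summable.of_norm_bounded
    (g := fun n : ℕ => ‖β ^ l‖ * ‖β‖ ^ n)
    ((summable_geometric_of_lt_one (norm_nonneg β) h1).mul_left _) fun n => ?_
  rw [norm_mul, zpow_add₀ h0, norm_mul, zpow_natCast, norm_pow]
  rcases (isSeq_iff.1 hε).1 n with h | h <;> rw [h]
  · simp; positivity
  · simp

/-- Up to the nonzero factor `β⁴ β⁻ˡ`, the difference of the two sums is the limit on the right. -/
theorem tsum_eq_tsum_iff_tendsto [CompleteSpace K] (h0 : β ≠ 0) (h1 : ‖β‖ < 1)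
    (hβ : β ^ 4 - β ^ 3 - β ^ 2 - β - 1 = 0) {l : ℤ} {ε ε' : ℤ → ℤ} (hε : IsSeq l ε)
    (hε' : IsSeq l ε') :
    ∑' n : ℕ, (ε (l + n) : K) * β ^ (l + n) = ∑' n : ℕ, (ε' (l + n) : K) * β ^ (l + n) ↔
      Tendsto (fun n => β ^ n * (trace l ε ε' n).eval β) atTop (𝓝 0) := by
  have hs := (summable_digits_mul_zpow h0 h1 hε).hasSum.sub
    (summable_digits_mul_zpow h0 h1 hε').hasSum
  have ht := (hs.tendsto_sum_nat.const_mul (β ^ 4 * β ^ (-l)))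
  have he : ∀ n : ℕ, β ^ 4 * β ^ (-l) * ∑ i ∈ Finset.range n,
      ((ε (l + i) : K) * β ^ (l + i) - (ε' (l + i) : K) * β ^ (l + i)) =
      β ^ n * (trace l ε ε' n).eval β := by
    intro n
    rw [pow_mul_eval_trace hβ, mul_assoc, Finset.mul_sum]
    congr 1
    refine Finset.sum_congr rfl fun j _ => ?_
    rw [zpow_add₀ h0, zpow_neg, zpow_natCast]
    have := zpow_ne_zero l h0
    push_cast
    field_simp
  simp only [he] at ht
  constructor
  · intro h
    simpa [h] using ht
  · intro h
    have := tendsto_nhds_unique ht h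
    have h2 : β ^ 4 * β ^ (-l) ≠ 0 := mul_ne_zero (pow_ne_zero _ h0) (zpow_ne_zero _ h0)
    exact sub_eq_zero.1 ((mul_eq_zero.1 this).resolve_left h2)

theorem norm_eval_trace_le (h0 : 0 < ‖β‖) (h1 : ‖β‖ < 1) (hβ : β ^ 4 - β ^ 3 - β ^ 2 - β - 1 = 0)
    {l : ℤ} {ε ε' : ℤ → ℤ} (hε : IsSeq l ε) (hε' : IsSeq l ε')
    (hlim : Tendsto (fun n => β ^ n * (trace l ε ε' n).eval β) atTop (𝓝 0)) (n : ℕ) :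
    ‖(trace l ε ε' n).eval β‖ ≤ ‖β‖ ^ 4 / (1 - ‖β‖) := by
  refine norm_le_of_tendsto_pow_mul (u := fun n => (trace l ε ε' n).eval β) h0 h1 (fun n => ?_)
    hlim n
  have : β * (trace l ε ε' (n + 1)).eval β - (trace l ε ε' n).eval β =
      ((ε (l + n) - ε' (l + n) : ℤ) : K) * β ^ 4 := by
    rw [trace, State.mul_eval_step hβ]
    ring
  rw [this, norm_mul, norm_pow]
  refine mul_le_of_le_one_left (by positivity) ?_
  rcases (isSeq_iff.1 hε).1 n with h | h <;> rcases (isSeq_iff.1 hε').1 n with h' | h' <;>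
    simp [h, h']

end Normed

/-! ### Numerical location of the roots -/

theorem real_root_bounds {β : ℝ} (hβ : β ^ 4 - β ^ 3 - β ^ 2 - β - 1 = 0) (h1 : |β| < 1) :
    -0.77481 < β ∧ β < -0.7748 := by
  obtain ⟨h2, h3⟩ := abs_lt.1 h1
  -- This is `(1 - x) P(x) = 2x⁴ - x⁵ - 1` at the root; for negative `β` the left side is monotone,
  -- which locates the root.
  have h4 : β ^ 4 * (2 - β) = 1 := by linear_combination (1 - β) * hβ
  have h5 : β < 0 := by
    by_contra! h
    have : β ^ 4 ≤ 1 := pow_le_one₀ h h3.le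
    have : 0 ≤ β ^ 3 := by positivity
    have : 0 ≤ β ^ 2 := by positivity
    have : β ^ 4 * (2 - β) = 1 := h4
    nlinarith [pow_lt_one₀ h h3 (n := 4) (by norm_num)]
  constructor
  · by_contra! h
    have h6 : (0.77481 : ℝ) ^ 4 ≤ (-β) ^ 4 := pow_le_pow_left₀ (by norm_num) (by linarith) 4
    rw [Even.neg_pow (by decide)] at h6
    have := mul_le_mul h6 (show (2.77481 : ℝ) ≤ 2 - β by linarith) (by norm_num) (by positivity)
    rw [h4] at this
    norm_num at this
  · by_contra! h
    have h6 : (-β) ^ 4 ≤ (0.7748 : ℝ) ^ 4 := pow_le_pow_left₀ (by linarith) (by linarith) 4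
    rw [Even.neg_pow (by decide)] at h6
    have := mul_le_mul h6 (show 2 - β ≤ (2.7748 : ℝ) by linarith) (by linarith) (by norm_num)
    rw [h4] at this
    norm_num at this

/-- The equations for the trace and the norm of a non-real root. -/
theorem complex_root_equations {β : ℂ} (hβ : β ^ 4 - β ^ 3 - β ^ 2 - β - 1 = 0) (him : β.im ≠ 0) :
    2 * β.re * (Complex.normSq β ^ 2 + 1) = Complex.normSq β * (Complex.normSq β - 1) ∧
    Complex.normSq β ^ 6 + Complex.normSq β ^ 5 + 2 * Complex.normSq β ^ 4 +
      2 * Complex.normSq β ^ 3 - 2 * Complex.normSq β ^ 2 + Complex.normSq β - 1 = 0 := by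
  set n := Complex.normSq β with hn
  set t := 2 * β.re with ht
  have h2 : β ^ 2 = t * β - n := by
    apply Complex.ext
    · simp [pow_two, hn, ht, Complex.normSq_apply]; ring
    · simp [pow_two, ht]; ring
  -- The remainder of `P` modulo the real quadratic `x² - t x + n`. As `β` is not real, both of its
  -- coefficients vanish.
  have h3 : (((t * (-1 - n + t * (t - 1)) - n * (t - 1) - 1 : ℝ) : ℂ)) * β +
      ((-1 - n * (-1 - n + t * (t - 1)) : ℝ) : ℂ) = 0 := by
    push_cast
    linear_combination hβ - (β ^ 2 + (t - 1) * β + (-1 - n + t * (t - 1))) * h2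
  have h4 : t * (-1 - n + t * (t - 1)) - n * (t - 1) - 1 = 0 := by
    have := congrArg Complex.im h3
    rw [Complex.add_im, Complex.im_ofReal_mul, Complex.ofReal_im, add_zero, Complex.zero_im] at this
    exact (mul_eq_zero.1 this).resolve_right him
  have h5 : -1 - n * (-1 - n + t * (t - 1)) = 0 := by
    rw [h4] at h3
    rw [Complex.ofReal_zero, zero_mul, zero_add] at h3
    exact_mod_cast h3
  have h6 : t * (n ^ 2 + 1) = n * (n - 1) := by linear_combination -n * h4 - t * h5
  refine ⟨h6, ?_⟩
  -- Clearing denominators lets `h6` eliminate `t`, which occurs to degree two.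
  have h7 : (n ^ 2 + 1) ^ 2 * (n * (-1 - n + t * (t - 1)) + 1) = 0 := by
    linear_combination -(n ^ 2 + 1) ^ 2 * h5
  linear_combination -h7 + n * (t * (n ^ 2 + 1) + n * (n - 1) - (n ^ 2 + 1)) * h6

theorem complex_root_bounds {n t : ℝ} (hn : 0 ≤ n) (h1 : t * (n ^ 2 + 1) = n * (n - 1))
    (h2 : n ^ 6 + n ^ 5 + 2 * n ^ 4 + 2 * n ^ 3 - 2 * n ^ 2 + n - 1 = 0) :
    (0.66957 < n ∧ n < 0.66958) ∧ -0.15277 < t ∧ t < -0.15275 := by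
  have mono : ∀ x y : ℝ, 0 ≤ x → x ≤ y →
      x ^ 6 + x ^ 5 + 2 * x ^ 4 + 2 * x ^ 3 - 2 * x ^ 2 + x - 1 ≤
      y ^ 6 + y ^ 5 + 2 * y ^ 4 + 2 * y ^ 3 - 2 * y ^ 2 + y - 1 := by
    intro x y hx hxy
    have h6 := pow_le_pow_left₀ hx hxy 6
    have h5 := pow_le_pow_left₀ hx hxy 5
    have h4 := pow_le_pow_left₀ hx hxy 4
    -- The increment of `2x³ - 2x² + x`, the only part of the sextic with a negative coefficient.
    have : 0 ≤ (y - x) * ((x + y - 1) ^ 2 + x ^ 2 + y ^ 2) :=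
      mul_nonneg (by linarith) (by positivity)
    nlinarith
  have hn1 : 0.66957 < n := by
    by_contra! h
    have := mono _ _ hn h
    rw [h2] at this
    norm_num at this
  have hn2 : n < 0.66958 := by
    by_contra! h
    have := mono _ _ (by norm_num) h
    rw [h2] at this
    norm_num at this
  refine ⟨⟨hn1, hn2⟩, ?_, ?_⟩
  · by_contra! h
    nlinarith
  · by_contra! h
    nlinarith

theorem real_root_pow_div_le {β : ℝ} (h : -0.77481 < β ∧ β < -0.7748) :
    ‖β‖ ^ 4 / (1 - ‖β‖) ≤ 1.601 := by
  rw [Real.norm_eq_abs]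
  have h1 : |β| ≤ 0.77481 := by rw [abs_le]; constructor <;> linarith
  rw [div_le_iff₀ (by linarith)]
  have := pow_le_pow_left₀ (abs_nonneg β) h1 4
  norm_num at this ⊢
  linarith

theorem complex_root_norm_lt {β : ℂ} (h : Complex.normSq β < 0.66958) : ‖β‖ < 0.8183 := by
  rw [Complex.normSq_eq_norm_sq] at h
  by_contra! h1
  nlinarith

theorem complex_root_pow_div_sq_le {β : ℂ} (h : Complex.normSq β < 0.66958) :
    (‖β‖ ^ 4 / (1 - ‖β‖)) ^ 2 ≤ 6.092 := by
  have h1 := complex_root_norm_lt h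
  have h2 : ‖β‖ ^ 4 / (1 - ‖β‖) ≤ 2.468 := by
    rw [div_le_iff₀ (by linarith)]
    rw [Complex.normSq_eq_norm_sq] at h
    have := pow_le_pow_left₀ (sq_nonneg ‖β‖) h.le 2
    norm_num at this ⊢
    nlinarith
  have h3 : 0 ≤ ‖β‖ ^ 4 / (1 - ‖β‖) := div_nonneg (by positivity) (by linarith)
  nlinarith

/-! ### Soundness of the size test -/

/-- The cross terms contain `2 Re βᵏ` for `k = 1, 2, 3`, that is `t`, `t² - 2n`, `t³ - 3nt`. -/
theorem State.normSq_eval (β : ℂ) (s : State) {n t : ℝ} (hn : n = Complex.normSq β)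
    (ht : t = 2 * β.re) : Complex.normSq (s.eval β) =
      s.a ^ 2 + n * s.b ^ 2 + n ^ 2 * s.c ^ 2 + n ^ 3 * s.d ^ 2 + t * (s.a * s.b)
        + (t ^ 2 - 2 * n) * (s.a * s.c) + (t ^ 3 - 3 * n * t) * (s.a * s.d) + n * t * (s.b * s.c)
        + n * (t ^ 2 - 2 * n) * (s.b * s.d) + n ^ 2 * t * (s.c * s.d) := by
  obtain ⟨x, y⟩ := β
  have h : s.eval (⟨x, y⟩ : ℂ) =
      ⟨s.a + s.b * x + s.c * (x ^ 2 - y ^ 2) + s.d * (x ^ 3 - 3 * x * y ^ 2),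
      s.b * y + s.c * (2 * x * y) + s.d * (3 * x ^ 2 * y - y ^ 3)⟩ := by
    apply Complex.ext
    · simp [State.eval, pow_succ, -mul_eq_mul_left_iff]; ring
    · simp [State.eval, pow_succ, -mul_eq_mul_left_iff]; ring
  rw [h, hn, ht, Complex.normSq_mk, Complex.normSq_mk]
  ring

theorem neg_le_mul_of_abs_le_one {e : ℝ} (he : |e| ≤ 1) (x : ℝ) : -|x| ≤ e * x := by
  have : |e * x| ≤ |x| := by
    rw [abs_mul]; exact mul_le_of_le_one_left (abs_nonneg x) he
  exact (abs_le.1 this).1.trans' (by simp)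

/-- The integers approximate `10000` times the true coefficients with error at most `1`, so the
total error is at most the sum of the absolute monomials, hence at most the square. -/
theorem quadratic_form_le {n t : ℝ} (hn : 0.66957 < n ∧ n < 0.66958)
    (ht : -0.15277 < t ∧ t < -0.15275) (a b c d : ℝ) :
    10000 * a ^ 2 + 6696 * b ^ 2 + 4483 * c ^ 2 + 3002 * d ^ 2 - 1528 * (a * b) - 13158 * (a * c)
      + 3033 * (a * d) - 1023 * (b * c) - 8810 * (b * d) - 685 * (c * d) ≤
    10000 * (a ^ 2 + n * b ^ 2 + n ^ 2 * c ^ 2 + n ^ 3 * d ^ 2 + t * (a * b)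
        + (t ^ 2 - 2 * n) * (a * c) + (t ^ 3 - 3 * n * t) * (a * d) + n * t * (b * c)
        + n * (t ^ 2 - 2 * n) * (b * d) + n ^ 2 * t * (c * d)) + (|a| + |b| + |c| + |d|) ^ 2 := by
  have hn2 : 0.44832 < n ^ 2 ∧ n ^ 2 < 0.44834 := by constructor <;> nlinarith
  have hn3 : 0.30018 < n ^ 3 ∧ n ^ 3 < 0.30021 := by constructor <;> nlinarith
  have ht2 : 0.02333 < t ^ 2 ∧ t ^ 2 < 0.02334 := by constructor <;> nlinarith
  have ht3 : -0.003567 < t ^ 3 ∧ t ^ 3 < -0.003563 := by constructor <;> nlinarith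
  have hnt : -0.10230 < n * t ∧ n * t < -0.10227 := by constructor <;> nlinarith
  have hntt : 0.01561 < n * t ^ 2 ∧ n * t ^ 2 < 0.01564 := by constructor <;> nlinarith
  have hnnt : -0.06850 < n ^ 2 * t ∧ n ^ 2 * t < -0.06847 := by constructor <;> nlinarith
  have e1 := neg_le_mul_of_abs_le_one (e := 10000 * n - 6696)
    (abs_le.2 (by constructor <;> linarith)) (b ^ 2)
  have e2 := neg_le_mul_of_abs_le_one (e := 10000 * n ^ 2 - 4483)
    (abs_le.2 (by constructor <;> linarith)) (c ^ 2)
  have e3 := neg_le_mul_of_abs_le_one (e := 10000 * n ^ 3 - 3002)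
    (abs_le.2 (by constructor <;> linarith)) (d ^ 2)
  have e4 := neg_le_mul_of_abs_le_one (e := 10000 * t + 1528)
    (abs_le.2 (by constructor <;> linarith)) (a * b)
  have e5 := neg_le_mul_of_abs_le_one (e := 10000 * (t ^ 2 - 2 * n) + 13158)
    (abs_le.2 (by constructor <;> linarith)) (a * c)
  have e6 := neg_le_mul_of_abs_le_one (e := 10000 * (t ^ 3 - 3 * (n * t)) - 3033)
    (abs_le.2 (by constructor <;> linarith)) (a * d)
  have e7 := neg_le_mul_of_abs_le_one (e := 10000 * (n * t) + 1023)
    (abs_le.2 (by constructor <;> linarith)) (b * c)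
  have e8 := neg_le_mul_of_abs_le_one (e := 10000 * (n * t ^ 2 - 2 * n ^ 2) + 8810)
    (abs_le.2 (by constructor <;> linarith)) (b * d)
  have e9 := neg_le_mul_of_abs_le_one (e := 10000 * (n ^ 2 * t) + 685)
    (abs_le.2 (by constructor <;> linarith)) (c * d)
  simp only [abs_mul, abs_pow] at e1 e2 e3 e4 e5 e6 e7 e8 e9
  have hab := mul_nonneg (abs_nonneg a) (abs_nonneg b)
  have hac := mul_nonneg (abs_nonneg a) (abs_nonneg c)
  have had := mul_nonneg (abs_nonneg a) (abs_nonneg d)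
  have hbc := mul_nonneg (abs_nonneg b) (abs_nonneg c)
  have hbd := mul_nonneg (abs_nonneg b) (abs_nonneg d)
  have hcd := mul_nonneg (abs_nonneg c) (abs_nonneg d)
  have haa := sq_nonneg |a|
  linear_combination e1 + e2 + e3 + e4 + e5 + e6 + e7 + e8 + e9 + hab + hac + had + hbc + hbd
    + hcd + haa

/-- The thresholds `16010` and `60920` are the two bounds scaled by `10000`; the terms added to them
in the test absorb the rounding of the coefficients. -/
theorem State.outside_eq_false {β₂ : ℝ} {β₃ : ℂ} (h2 : -0.77481 < β₂ ∧ β₂ < -0.7748)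
    (hn : 0.66957 < Complex.normSq β₃ ∧ Complex.normSq β₃ < 0.66958)
    (ht : -0.15277 < 2 * β₃.re ∧ 2 * β₃.re < -0.15275) {s : State}
    (hs2 : ‖s.eval β₂‖ ≤ 1.601) (hs3 : Complex.normSq (s.eval β₃) ≤ 6.092) :
    s.outside = false := by
  rw [State.outside, Bool.or_eq_false_iff, decide_eq_false_iff_not, decide_eq_false_iff_not, not_lt,
    not_lt]
  constructor
  · zify
    rw [← Int.cast_le (R := ℝ)]
    push_cast
    have hb : 0.600315 < β₂ ^ 2 ∧ β₂ ^ 2 < 0.600331 := by constructor <;> nlinarith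
    have hc : -0.465143 < β₂ ^ 3 ∧ β₂ ^ 3 < -0.465123 := by constructor <;> nlinarith
    have e1 := neg_le_mul_of_abs_le_one (e := 10000 * β₂ + 7748)
      (abs_le.2 (by constructor <;> linarith))
    have e2 := neg_le_mul_of_abs_le_one (e := 10000 * β₂ ^ 2 - 6003)
      (abs_le.2 (by constructor <;> linarith))
    have e3 := neg_le_mul_of_abs_le_one (e := 10000 * β₂ ^ 3 + 4651)
      (abs_le.2 (by constructor <;> linarith))
    obtain ⟨h3, h4⟩ := abs_le.1 hs2
    rw [State.eval] at h3 h4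
    refine abs_le.2 ⟨?_, ?_⟩
    · have f1 := e1 (-s.b)
      have f2 := e2 (-s.c)
      have f3 := e3 (-s.d)
      rw [abs_neg] at f1 f2 f3
      linarith
    · linarith [e1 s.b, e2 s.c, e3 s.d]
  · rw [← Int.cast_le (R := ℝ)]
    zify
    rw [State.normSq_eval β₃ s rfl rfl] at hs3
    linarith [quadratic_form_le hn ht s.a s.b s.c s.d]

/-! ### The explicit set `S` and the live states -/

/-- The element of `ℝ × ℂ` that belongs to a state. -/
noncomputable def State.embed (β₂ : ℝ) (β₃ : ℂ) (s : State) : ℝ × ℂ := (s.eval β₂, s.eval β₃)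

/-- The elements of `ℤ[α]` that make up half of the set of states. -/
def basicVectors : List State :=
  [⟨0, 0, 0, 0, 0, 0⟩, ⟨0, 0, 0, 1, 0, 0⟩, ⟨0, 0, 1, 0, 0, 0⟩, ⟨0, 0, 1, 1, 0, 0⟩,
    ⟨0, 1, 0, 0, 0, 0⟩, ⟨0, 1, 0, 1, 0, 0⟩, ⟨0, 1, 1, 0, 0, 0⟩, ⟨0, 1, 1, 1, 0, 0⟩,
    ⟨1, 0, 0, 0, 0, 0⟩, ⟨1, 0, 0, 1, 0, 0⟩, ⟨1, 0, 1, 0, 0, 0⟩, ⟨1, 0, 1, 1, 0, 0⟩,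
    ⟨1, 1, 0, 0, 0, 0⟩, ⟨1, 1, 0, 1, 0, 0⟩, ⟨1, 1, 1, 0, 0, 0⟩, ⟨0, -1, 0, 1, 0, 0⟩,
    ⟨-1, 0, 1, 0, 0, 0⟩, ⟨1, 2, 1, 0, 0, 0⟩]

/-- Equality of the elements of `ℤ[α]` that belong to two states, as a Boolean test. -/
def State.sameVector (s t : State) : Bool :=
  decide (s.a = t.a) && (decide (s.b = t.b) && (decide (s.c = t.c) && decide (s.d = t.d)))

/-- The state with the opposite element of `ℤ[α]`. -/
def State.neg (s : State) : State := ⟨-s.a, -s.b, -s.c, -s.d, s.h, s.g⟩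

theorem State.embed_neg (β₂ : ℝ) (β₃ : ℂ) (s : State) :
    s.neg.embed β₂ β₃ = -s.embed β₂ β₃ := by
  simp only [State.embed, State.eval, State.neg, Prod.neg_mk, Prod.mk.injEq]
  push_cast
  constructor <;> ring

theorem State.embed_eq_of_sameVector (β₂ : ℝ) (β₃ : ℂ) {s t : State} (h : s.sameVector t = true) :
    s.embed β₂ β₃ = t.embed β₂ β₃ := by
  simp only [State.sameVector, Bool.and_eq_true, decide_eq_true_eq] at h
  obtain ⟨h1, h2, h3, h4⟩ := h
  simp only [State.embed, State.eval, h1, h2, h3, h4]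

theorem liveStates_all_sameVector : (liveStates.all fun s => basicVectors.any fun t =>
    s.sameVector t || s.neg.sameVector t) = true := by decide +kernel

theorem basicVectors_all_sameVector : (basicVectors.all fun t =>
    (liveStates.any fun s => s.sameVector t) &&
      liveStates.any fun s => s.neg.sameVector t) = true := by
  decide +kernel

section

variable {β₂ : ℝ} {β₃ : ℂ}

theorem sum_smul_alphaPow (c : ℤ → ℤ) : ∑ i ∈ Finset.Icc (0 : ℤ) 3, c i • alphaPow β₂ β₃ i =
    State.embed β₂ β₃ ⟨c 0, c 1, c 2, c 3, 0, 0⟩ := by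
  rw [show (3 : ℤ) = 0 + (3 : ℕ) by norm_num, sum_Icc_add_eq_sum_range]
  simp [Finset.sum_range_succ, alphaPow, State.embed, State.eval]

theorem embed_mem_basicStates {a b c d : ℤ} (ha : a = 0 ∨ a = 1) (hb : b = 0 ∨ b = 1)
    (hc : c = 0 ∨ c = 1) (hd : d = 0 ∨ d = 1) (h : ¬ (d = 1 ∧ c = 1 ∧ b = 1 ∧ a = 1)) :
    State.embed β₂ β₃ ⟨a, b, c, d, 0, 0⟩ ∈ basicStates β₂ β₃ := by
  refine Or.inl ⟨fun i => if i = 0 then a else if i = 1 then b else if i = 2 then c else d,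
    ⟨fun i _ _ => ?_, fun i hi hi' => ?_⟩, ?_⟩
  · dsimp only
    split_ifs <;> assumption
  · obtain rfl : i = 3 := by omega
    simpa using h
  · rw [sum_smul_alphaPow]
    simp

/-- The last two follow from `β⁴ (2 - β) = 1`. -/
theorem zpow_neg_eq {K : Type*} [Field K] {β : K} (hβ : β ^ 4 - β ^ 3 - β ^ 2 - β - 1 = 0) :
    β ^ (-1 : ℤ) = β ^ 3 - β ^ 2 - β - 1 ∧ β ^ (-2 : ℤ) = 2 * β ^ 2 - β ^ 3 ∧
      β ^ (-3 : ℤ) = 2 * β - β ^ 2 := by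
  refine ⟨?_, ?_, ?_⟩
  · rw [zpow_neg, show β ^ (1 : ℤ) = β from zpow_one β]
    exact inv_eq_of_mul_eq_one_right (by linear_combination hβ)
  · rw [zpow_neg, show β ^ (2 : ℤ) = β ^ 2 by norm_cast]
    exact inv_eq_of_mul_eq_one_right (by linear_combination (1 - β) * hβ)
  · rw [zpow_neg, show β ^ (3 : ℤ) = β ^ 3 by norm_cast]
    exact inv_eq_of_mul_eq_one_right (by linear_combination (1 - β) * hβ)

theorem embed_exceptional (h2 : β₂ ^ 4 - β₂ ^ 3 - β₂ ^ 2 - β₂ - 1 = 0)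
    (h3 : β₃ ^ 4 - β₃ ^ 3 - β₃ ^ 2 - β₃ - 1 = 0) :
    alphaPow β₂ β₃ (-1) + alphaPow β₂ β₃ 0 + alphaPow β₂ β₃ 2 =
      State.embed β₂ β₃ ⟨0, -1, 0, 1, 0, 0⟩ ∧
    alphaPow β₂ β₃ (-2) + alphaPow β₂ β₃ (-1) + alphaPow β₂ β₃ 1 =
      State.embed β₂ β₃ ⟨-1, 0, 1, 0, 0, 0⟩ ∧
    alphaPow β₂ β₃ (-3) + alphaPow β₂ β₃ (-2) + alphaPow β₂ β₃ 0 + alphaPow β₂ β₃ 3 =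
      State.embed β₂ β₃ ⟨1, 2, 1, 0, 0, 0⟩ := by
  obtain ⟨a1, a2, a3⟩ := zpow_neg_eq h2
  obtain ⟨b1, b2, b3⟩ := zpow_neg_eq h3
  have c2 : β₂ ^ (2 : ℤ) = β₂ ^ 2 := by norm_cast
  have c3 : β₂ ^ (3 : ℤ) = β₂ ^ 3 := by norm_cast
  have d2 : β₃ ^ (2 : ℤ) = β₃ ^ 2 := by norm_cast
  have d3 : β₃ ^ (3 : ℤ) = β₃ ^ 3 := by norm_cast
  simp only [alphaPow, State.embed, State.eval, Prod.mk_add_mk, Prod.mk.injEq, a1, a2, a3, b1, b2,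
    b3, c2, c3, d2, d3, zpow_zero, zpow_one]
  push_cast
  refine ⟨⟨?_, ?_⟩, ⟨?_, ?_⟩, ?_, ?_⟩ <;> ring

theorem basicStates_eq (h2 : β₂ ^ 4 - β₂ ^ 3 - β₂ ^ 2 - β₂ - 1 = 0)
    (h3 : β₃ ^ 4 - β₃ ^ 3 - β₃ ^ 2 - β₃ - 1 = 0) :
    basicStates β₂ β₃ = State.embed β₂ β₃ '' {s | s ∈ basicVectors} := by
  obtain ⟨e1, e2, e3⟩ := embed_exceptional h2 h3
  apply Set.Subset.antisymm
  · rintro z (⟨c, ⟨hc, hc'⟩, rfl⟩ | hz)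
    · rw [sum_smul_alphaPow]
      refine ⟨_, ?_, rfl⟩
      have h := hc' 3 (by norm_num) le_rfl
      norm_num at h
      rcases hc 0 (by norm_num) (by norm_num) with h0 | h0 <;>
      rcases hc 1 (by norm_num) (by norm_num) with h1 | h1 <;>
      rcases hc 2 (by norm_num) (by norm_num) with h2 | h2 <;>
      rcases hc 3 (by norm_num) (by norm_num) with h3 | h3 <;>
      simp [h0, h1, h2, h3, basicVectors] at h ⊢
    · rcases hz with rfl | rfl | rfl
      · exact ⟨_, by simp [basicVectors], e1.symm⟩
      · exact ⟨_, by simp [basicVectors], e2.symm⟩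
      · exact ⟨_, by simp [basicVectors], e3.symm⟩
  · rintro _ ⟨s, hs, rfl⟩
    simp only [basicVectors, List.mem_cons, List.not_mem_nil, or_false, Set.mem_ofPred_eq] at hs
    rcases hs with rfl | rfl | rfl | rfl | rfl | rfl | rfl | rfl | rfl | rfl | rfl | rfl | rfl | rfl |
      rfl | rfl | rfl | rfl
    -- Of the 16 binary words of length four only `1111` is excluded; the three remaining vectors
    -- are the exceptional ones.
    iterate 15 exact embed_mem_basicStates (by simp) (by simp) (by simp) (by simp) (by simp)
    · exact Or.inr (by rw [← e1]; simp)
    · exact Or.inr (by rw [← e2]; simp)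
    · exact Or.inr (by rw [← e3]; simp)

theorem states_eq (h2 : β₂ ^ 4 - β₂ ^ 3 - β₂ ^ 2 - β₂ - 1 = 0)
    (h3 : β₃ ^ 4 - β₃ ^ 3 - β₃ ^ 2 - β₃ - 1 = 0) :
    states β₂ β₃ = State.embed β₂ β₃ '' {s | s ∈ liveStates} := by
  rw [states, basicStates_eq h2 h3]
  apply Set.Subset.antisymm
  · rintro z (⟨t, ht, hz⟩ | ⟨t, ht, hz⟩) <;>
      have h := List.all_eq_true.1 basicVectors_all_sameVector t ht <;>
      rw [Bool.and_eq_true, List.any_eq_true, List.any_eq_true] at h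
    · obtain ⟨s, hs, h⟩ := h.1
      exact ⟨s, hs, (State.embed_eq_of_sameVector β₂ β₃ h).trans hz⟩
    · obtain ⟨s, hs, h⟩ := h.2
      refine ⟨s, hs, neg_injective ?_⟩
      rw [← hz, ← State.embed_neg, State.embed_eq_of_sameVector β₂ β₃ h]
  · rintro _ ⟨s, hs, rfl⟩
    obtain ⟨t, ht, h⟩ := List.any_eq_true.1 (List.all_eq_true.1 liveStates_all_sameVector s hs)
    rw [Bool.or_eq_true] at h
    rcases h with h | h
    · exact Or.inl ⟨t, ht, (State.embed_eq_of_sameVector β₂ β₃ h).symm⟩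
    · exact Or.inr ⟨t, ht, by rw [← State.embed_neg, State.embed_eq_of_sameVector β₂ β₃ h]⟩

/-! ### Partial differences and values in `ℝ × ℂ` -/

theorem A_add_natCast (hβ₂ : β₂ ≠ 0) (hβ₃ : β₃ ≠ 0) (h2 : β₂ ^ 4 - β₂ ^ 3 - β₂ ^ 2 - β₂ - 1 = 0)
    (h3 : β₃ ^ 4 - β₃ ^ 3 - β₃ ^ 2 - β₃ - 1 = 0) (l : ℤ) (ε ε' : ℤ → ℤ) (n : ℕ) :
    A β₂ β₃ l ε ε' (l + n) = (trace l ε ε' (n + 1)).embed β₂ β₃ := by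
  rw [State.embed, ← zpow_mul_sum_Icc hβ₂ h2, ← zpow_mul_sum_Icc hβ₃ h3, A]
  apply Prod.ext
  · simp [alphaPow, Prod.fst_sum]
  · simp [alphaPow, Prod.snd_sum]

theorem diffSet_eq_range (hβ₂ : β₂ ≠ 0) (hβ₃ : β₃ ≠ 0)
    (h2 : β₂ ^ 4 - β₂ ^ 3 - β₂ ^ 2 - β₂ - 1 = 0) (h3 : β₃ ^ 4 - β₃ ^ 3 - β₃ ^ 2 - β₃ - 1 = 0)
    (l : ℤ) (ε ε' : ℤ → ℤ) : diffSet β₂ β₃ l ε ε' =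
      Set.range fun n : ℕ => (trace l ε ε' (n + 1)).embed β₂ β₃ := by
  ext z
  constructor
  · rintro ⟨k, hk, rfl⟩
    obtain ⟨n, rfl⟩ := Int.le.dest hk
    exact ⟨n, (A_add_natCast hβ₂ hβ₃ h2 h3 l ε ε' n).symm⟩
  · rintro ⟨n, rfl⟩
    exact ⟨l + n, by omega, (A_add_natCast hβ₂ hβ₃ h2 h3 l ε ε' n).symm⟩

/-- The enumeration `n ↦ l + n` of the integers `i ≥ l`. -/
def natEquivIci (l : ℤ) : ℕ ≃ Set.Ici l where
  toFun n := ⟨l + n, by simp⟩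
  invFun i := (i.1 - l).toNat
  left_inv n := by simp
  right_inv i := by
    have := i.2
    rw [Set.mem_Ici] at this
    ext
    simp only
    omega

theorem hasSum_term (hβ₂ : β₂ ≠ 0) (hβ₃ : β₃ ≠ 0) (hn₂ : ‖β₂‖ < 1) (hn₃ : ‖β₃‖ < 1) {l : ℤ}
    {ε : ℤ → ℤ} (hε : IsSeq l ε) : HasSum (term β₂ β₃ l ε)
      (∑' n : ℕ, (ε (l + n) : ℝ) * β₂ ^ (l + n), ∑' n : ℕ, (ε (l + n) : ℂ) * β₃ ^ (l + n)) := by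
  rw [← (natEquivIci l).hasSum_iff]
  convert (summable_digits_mul_zpow hβ₂ hn₂ hε).hasSum.prodMk
    (summable_digits_mul_zpow hβ₃ hn₃ hε).hasSum using 2 with n
  simp [term, alphaPow, natEquivIci]

theorem value_eq_value_iff (hβ₂ : β₂ ≠ 0) (hβ₃ : β₃ ≠ 0) (hn₂ : ‖β₂‖ < 1) (hn₃ : ‖β₃‖ < 1)
    (h2 : β₂ ^ 4 - β₂ ^ 3 - β₂ ^ 2 - β₂ - 1 = 0) (h3 : β₃ ^ 4 - β₃ ^ 3 - β₃ ^ 2 - β₃ - 1 = 0)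
    {l : ℤ} {ε ε' : ℤ → ℤ} (hε : IsSeq l ε) (hε' : IsSeq l ε') :
    value β₂ β₃ l ε = value β₂ β₃ l ε' ↔
      Tendsto (fun n => β₂ ^ n * (trace l ε ε' n).eval β₂) atTop (𝓝 0) ∧
      Tendsto (fun n => β₃ ^ n * (trace l ε ε' n).eval β₃) atTop (𝓝 0) := by
  rw [value, value, (hasSum_term hβ₂ hβ₃ hn₂ hn₃ hε).tsum_eq,
    (hasSum_term hβ₂ hβ₃ hn₂ hn₃ hε').tsum_eq, Prod.mk.injEq,
    tsum_eq_tsum_iff_tendsto hβ₂ hn₂ h2 hε hε', tsum_eq_tsum_iff_tendsto hβ₃ hn₃ h3 hε hε']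

/-- A finite set is bounded, and `βⁿ` times a bounded sequence tends to `0`. -/
theorem value_eq_value_of_finite (hβ₂ : β₂ ≠ 0) (hβ₃ : β₃ ≠ 0) (hn₂ : ‖β₂‖ < 1) (hn₃ : ‖β₃‖ < 1)
    (h2 : β₂ ^ 4 - β₂ ^ 3 - β₂ ^ 2 - β₂ - 1 = 0) (h3 : β₃ ^ 4 - β₃ ^ 3 - β₃ ^ 2 - β₃ - 1 = 0)
    {l : ℤ} {ε ε' : ℤ → ℤ} (hε : IsSeq l ε) (hε' : IsSeq l ε')
    (hfin : (diffSet β₂ β₃ l ε ε').Finite) : value β₂ β₃ l ε = value β₂ β₃ l ε' := by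
  rw [value_eq_value_iff hβ₂ hβ₃ hn₂ hn₃ h2 h3 hε hε']
  rw [diffSet_eq_range hβ₂ hβ₃ h2 h3] at hfin
  obtain ⟨C, hC⟩ := hfin.isBounded.exists_norm_le
  have hC' : ∀ n, ‖(trace l ε ε' n).embed β₂ β₃‖ ≤ max C 0 := by
    intro n
    cases n with
    | zero => simp [trace, State.start, State.embed, State.eval]
    | succ n => exact (hC _ ⟨n, rfl⟩).trans (le_max_left _ _)
  exact ⟨tendsto_pow_mul_of_norm_le hn₂ fun n => (norm_fst_le _).trans (hC' n),
    tendsto_pow_mul_of_norm_le hn₃ fun n => (norm_snd_le _).trans (hC' n)⟩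

theorem trace_mem_liveStates (hβ₂ : -0.77481 < β₂ ∧ β₂ < -0.7748)
    (hn : 0.66957 < Complex.normSq β₃ ∧ Complex.normSq β₃ < 0.66958)
    (ht : -0.15277 < 2 * β₃.re ∧ 2 * β₃.re < -0.15275) (hβ₂0 : β₂ ≠ 0) (hβ₃ : β₃ ≠ 0)
    (hn₂ : ‖β₂‖ < 1) (hn₃ : ‖β₃‖ < 1)
    (h2 : β₂ ^ 4 - β₂ ^ 3 - β₂ ^ 2 - β₂ - 1 = 0) (h3 : β₃ ^ 4 - β₃ ^ 3 - β₃ ^ 2 - β₃ - 1 = 0)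
    {l : ℤ} {ε ε' : ℤ → ℤ} (hε : IsSeq l ε) (hε' : IsSeq l ε')
    (h : value β₂ β₃ l ε = value β₂ β₃ l ε') (n : ℕ) : trace l ε ε' n ∈ liveStates := by
  obtain ⟨t2, t3⟩ := (value_eq_value_iff hβ₂0 hβ₃ hn₂ hn₃ h2 h3 hε hε').1 h
  refine (isPath_trace_iff.2 ⟨hε, hε'⟩).mem_liveStates rfl (fun n => ?_) n
  refine State.outside_eq_false hβ₂ hn ht ?_ ?_
  · exact (norm_eval_trace_le (norm_pos_iff.2 hβ₂0) hn₂ h2 hε hε' t2 n).trans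
      (real_root_pow_div_le hβ₂)
  · rw [Complex.normSq_eq_norm_sq]
    exact (pow_le_pow_left₀ (norm_nonneg _)
      (norm_eval_trace_le (norm_pos_iff.2 hβ₃) hn₃ h3 hε hε' t3 n) 2).trans
      (complex_root_pow_div_sq_le hn.2)

end

end Tetranacci

open Tetranacci in
theorem mainTheorem1 (β₂ : ℝ) (β₃ : ℂ)
    (hβ₂ : Polynomial.aeval β₂ Tetranacci.P = 0) (hβ₂_lt : |β₂| < 1)
    (hβ₃ : Polynomial.aeval β₃ Tetranacci.P = 0) (hβ₃_im : β₃.im ≠ 0) :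
    (∀ (l : ℤ) (ε : ℤ → ℤ), Tetranacci.IsSeq l ε → Summable (Tetranacci.term β₂ β₃ l ε)) ∧
    (∀ (l : ℤ) (ε ε' : ℤ → ℤ), Tetranacci.IsSeq l ε → Tetranacci.IsSeq l ε' →
      (Tetranacci.value β₂ β₃ l ε = Tetranacci.value β₂ β₃ l ε' ↔
        (Tetranacci.diffSet β₂ β₃ l ε ε').Finite) ∧
      (Tetranacci.value β₂ β₃ l ε = Tetranacci.value β₂ β₃ l ε' →
        Tetranacci.diffSet β₂ β₃ l ε ε' ⊆ Tetranacci.states β₂ β₃)) ∧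
    (Tetranacci.states β₂ β₃).Finite ∧
    Tetranacci.states β₂ β₃ =
      ⋃ p ∈ Tetranacci.Delta β₂ β₃, Tetranacci.diffSet β₂ β₃ p.1 p.2.1 p.2.2 := by
  rw [aeval_P] at hβ₂ hβ₃
  have b2 := real_root_bounds hβ₂ hβ₂_lt
  obtain ⟨e1, e2⟩ := complex_root_equations hβ₃ hβ₃_im
  obtain ⟨bn, bt⟩ := complex_root_bounds (Complex.normSq_nonneg β₃) e1 e2
  have n2 : β₂ ≠ 0 := by rintro rfl; norm_num at hβ₂
  have n3 : β₃ ≠ 0 := by rintro rfl; norm_num at hβ₃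
  have l3 : ‖β₃‖ < 1 := (complex_root_norm_lt bn.2).trans (by norm_num)
  have hst := states_eq hβ₂ hβ₃
  have hfin : (states β₂ β₃).Finite := by
    rw [hst]
    exact (List.finite_toSet liveStates).image _
  have hsub : ∀ (l : ℤ) (ε ε' : ℤ → ℤ), IsSeq l ε → IsSeq l ε' →
      value β₂ β₃ l ε = value β₂ β₃ l ε' → diffSet β₂ β₃ l ε ε' ⊆ states β₂ β₃ := by
    intro l ε ε' hε hε' h
    rw [diffSet_eq_range n2 n3 hβ₂ hβ₃, hst]
    rintro _ ⟨n, rfl⟩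
    exact ⟨_, trace_mem_liveStates b2 bn bt n2 n3 hβ₂_lt l3 hβ₂ hβ₃ hε hε' h (n + 1), rfl⟩
  refine ⟨fun l ε hε => (hasSum_term n2 n3 hβ₂_lt l3 hε).summable,
    fun l ε ε' hε hε' => ⟨⟨fun h => hfin.subset (hsub l ε ε' hε hε' h),
      value_eq_value_of_finite n2 n3 hβ₂_lt l3 hβ₂ hβ₃ hε hε'⟩, hsub l ε ε' hε hε'⟩, hfin, ?_⟩
  apply Set.Subset.antisymm
  · rw [hst]
    rintro _ ⟨s, hs, rfl⟩
    obtain ⟨t, p, ht, ht0, htl⟩ := exists_isPath_liveStates hs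
    obtain ⟨t', p', m, ht', ht'0, htt⟩ := (reachable_of_mem_liveStates hs).exists_isPath ht ht0
    obtain ⟨ε, ε', hε, hε', rfl⟩ := ht'.exists_trace ht'0
    have hd : diffSet β₂ β₃ 0 ε ε' = _ := diffSet_eq_range n2 n3 hβ₂ hβ₃ 0 ε ε'
    -- From index `m` on the path is live; the `m` earlier terms, on the way to `s`, add only
    -- finitely many elements.
    have hf : (diffSet β₂ β₃ 0 ε ε').Finite := by
      refine (hfin.union ((Finset.range m).finite_toSet.image
        fun n => (trace 0 ε ε' (n + 1)).embed β₂ β₃)).subset ?_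
      rw [hd]
      rintro _ ⟨n, rfl⟩
      rcases lt_or_ge n m with h | h
      · exact Or.inr ⟨n, by simpa using h, rfl⟩
      · obtain ⟨k, rfl⟩ := Nat.exists_eq_add_of_le' h
        refine Or.inl ?_
        rw [hst]
        exact ⟨_, htt k ▸ htl k, rfl⟩
    refine Set.mem_iUnion₂.2 ⟨(0, ε, ε'), ⟨hε, hε',
      value_eq_value_of_finite n2 n3 hβ₂_lt l3 hβ₂ hβ₃ hε hε' hf⟩, ?_⟩
    rw [hd]
    -- The state `s` is reached after `m + 1` digits, hence at `k = m`.
    exact ⟨m, by simp only; rw [← ht0, ← htt 0, Nat.zero_add]⟩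
  · exact Set.iUnion₂_subset fun p hp => hsub p.1 p.2.1 p.2.2 hp.1 hp.2.1 hp.2.2
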